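/- A \emph{cubic algebra} is a join semilattice $\mathcal L$ with greatest element $1$ and a binary operation $\Delta$ such that for all $x,y,z\in\mathcal L$: (a) $x\le y$ implies $\Delta(y,x)\vee x=y$; (b) $x\le y\le z$ implies $\Delta(z,\Delta(y,x))=\Delta(\Delta(z,y),\Delta(z,x))$; (c) $x\le y$ implies $\Delta(y,\Delta(y,x))=x$; (d) $x\le y\le z$ implies $\Delta(z,x)\le\Delta(z,y)$; and, writing $xy=\Delta(1,\Delta(x\vee y,y))\vee y$, (e) $(xy)y=x\vee y$; (f) $x(yz)=y(xz)$. Let $\mathcal L$ be a cubic algebra. For $a,b\in\mathcal L$ write $a\simeq b$ if $\Delta(a\vee b,a)=b$, and put $a*b=a\vee\Delta(a\vee b,b)$. Then: 1. for all $a,b,c,d\in\mathcal L$, if $a\simeq d$ and $b\simeq c$, then $a*b\simeq d*c$; 2. for all $a,b,c\in\mathcal L$, $a*(b*c)=(a*b)*c$. -/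

import Mathlib

/-- The derived operation `xy = Δ(1, Δ(x ∨ y, y)) ∨ y` of a join semilattice with top element
and a binary operation `Δ`. -/
def cubicArrow {L : Type*} [SemilatticeSup L] [OrderTop L] (Δ : L → L → L) (x y : L) : L :=
  Δ ⊤ (Δ (x ⊔ y) y) ⊔ y

/-- A cubic algebra: a join semilattice with a greatest element and a binary operation
`delta`, written `Δ(y, x)` in the usual notation, subject to the axioms below. The axioms
constrain `Δ(y, x)` only for `x ≤ y`; the remaining values are arbitrary. -/
class CubicAlgebra (L : Type*) extends SemilatticeSup L, OrderTop L where
  delta : L → L → L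
  delta_sup : ∀ x y : L, x ≤ y → delta y x ⊔ x = y
  delta_delta_of_le : ∀ x y z : L, x ≤ y → y ≤ z →
    delta z (delta y x) = delta (delta z y) (delta z x)
  delta_invol : ∀ x y : L, x ≤ y → delta y (delta y x) = x
  delta_mono : ∀ x y z : L, x ≤ y → y ≤ z → delta z x ≤ delta z y
  arrow_arrow : ∀ x y : L, cubicArrow delta (cubicArrow delta x y) y = x ⊔ y
  arrow_comm : ∀ x y z : L,
    cubicArrow delta x (cubicArrow delta y z) = cubicArrow delta y (cubicArrow delta x z)

namespace CubicAlgebra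

/-- The relation `a ≃ b`, that is, `Δ(a ∨ b, a) = b`. -/
def Simeq {L : Type*} [CubicAlgebra L] (a b : L) : Prop :=
  delta (a ⊔ b) a = b

/-- The operation `a * b = a ∨ Δ(a ∨ b, b)`. -/
def star {L : Type*} [CubicAlgebra L] (a b : L) : L :=
  a ⊔ delta (a ⊔ b) b

end CubicAlgebra

namespace CubicAlgebra

variable {L : Type*} [CubicAlgebra L]

/-! Under `imp`, L is an implication algebra, so its two-valued homomorphisms φ separate points
(`exists_isValuation`). Since `refl` preserves `imp`, each x is coded by the pairs (φ x, φ (refl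
x)), never both false. The value of `delta`, `star` and `Simeq` depends only on these pairs, so both
claims become propositional tautologies. -/

/-- The implication `x ⇨ y` of a cubic algebra. -/
def imp (x y : L) : L := cubicArrow delta x y

/-- The reflection `Δ(1, x)`. -/
def refl (x : L) : L := delta ⊤ x

theorem delta_le {x y : L} (h : x ≤ y) : delta y x ≤ y := by
  conv_rhs => rw [← delta_sup x y h]
  exact le_sup_left

theorem delta_self (x : L) : delta x x = x := by
  have h := delta_le (le_refl x)
  refine le_antisymm h ?_
  have h2 := delta_mono (delta x x) x x h le_rfl
  rwa [delta_invol x x le_rfl] at h2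

theorem refl_refl (x : L) : refl (refl x) = x := delta_invol x ⊤ le_top

theorem refl_mono {x y : L} (h : x ≤ y) : refl x ≤ refl y := delta_mono x y ⊤ h le_top

theorem refl_sup_self (x : L) : refl x ⊔ x = ⊤ := delta_sup x ⊤ le_top

theorem refl_sup (x y : L) : refl (x ⊔ y) = refl x ⊔ refl y := by
  apply le_antisymm
  · have h : x ⊔ y ≤ refl (refl x ⊔ refl y) := by
      apply sup_le
      · conv_lhs => rw [← refl_refl x]
        exact refl_mono le_sup_left
      · conv_lhs => rw [← refl_refl y]
        exact refl_mono le_sup_right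
    have h2 := refl_mono h
    rwa [refl_refl] at h2
  · exact sup_le (refl_mono le_sup_left) (refl_mono le_sup_right)

theorem refl_delta {x y : L} (h : x ≤ y) : refl (delta y x) = delta (refl y) (refl x) :=
  delta_delta_of_le x y ⊤ h le_top

theorem imp_def (x y : L) : imp x y = refl (delta (x ⊔ y) y) ⊔ y := rfl

theorem imp_imp_right (x y : L) : imp (imp x y) y = x ⊔ y := arrow_arrow x y

theorem imp_left_comm (x y z : L) : imp x (imp y z) = imp y (imp x z) := arrow_comm x y z

theorem sup_imp (x y : L) : imp (x ⊔ y) y = imp x y := by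
  simp [imp_def]

theorem le_imp (x y : L) : y ≤ imp x y := le_sup_right

theorem imp_eq_top_of_le {x y : L} (h : x ≤ y) : imp x y = ⊤ := by
  rw [imp_def, sup_eq_right.2 h, delta_self, refl_sup_self]

theorem top_imp (x : L) : imp ⊤ x = x := by
  have h := imp_imp_right x x
  rwa [imp_eq_top_of_le le_rfl, sup_idem] at h

theorem imp_eq_top {x y : L} : imp x y = ⊤ ↔ x ≤ y := by
  refine ⟨fun h => ?_, imp_eq_top_of_le⟩
  have h2 := imp_imp_right x y
  rw [h, top_imp] at h2
  exact sup_eq_right.1 h2.symm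

theorem imp_mono_right (x : L) {y z : L} (h : y ≤ z) : imp x y ≤ imp x z := by
  have h2 : imp (imp z y) y = z := by rw [imp_imp_right, sup_eq_left.2 h]
  rw [← h2, imp_left_comm]
  exact le_imp _ _

theorem imp_le_imp_imp (x y z : L) : imp x y ≤ imp (imp y z) (imp x z) := by
  rw [imp_left_comm, imp_imp_right]
  exact imp_mono_right x le_sup_left

theorem sup_imp_eq_top (x y : L) : x ⊔ imp x y = ⊤ := by
  have h := refl_sup_self (delta (x ⊔ y) y)
  have h2 : delta (x ⊔ y) y ≤ x ⊔ y := delta_le le_sup_right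
  rw [imp_def, eq_top_iff, ← h]
  refine sup_le (le_sup_left.trans le_sup_right) (h2.trans ?_)
  exact sup_le le_sup_left (le_sup_right.trans le_sup_right)

theorem imp_eq_of_sup_eq_top {x y : L} (h : x ⊔ y = ⊤) : imp x y = y := by
  rw [← sup_imp, h, top_imp]

theorem imp_contract (x y : L) : imp x (imp x y) = imp x y :=
  imp_eq_of_sup_eq_top (sup_imp_eq_top x y)

theorem imp_le_imp_sup (x y z : L) : imp x z ≤ imp x y ⊔ z := by
  have h : imp x (imp x y ⊔ z) = imp x y ⊔ z := by
    apply imp_eq_of_sup_eq_top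
    rw [← sup_assoc, sup_imp_eq_top, top_sup_eq]
  exact (imp_mono_right x le_sup_right).trans h.le

theorem refl_imp (x y : L) : refl (imp x y) = imp (refl x) (refl y) := by
  rw [imp_def, imp_def, ← refl_sup x y, ← refl_delta le_sup_right, refl_sup]

/-- This expresses `delta` through `imp` and `refl`, which lets valuations evaluate it. -/
theorem imp_delta {x y : L} (h : x ≤ y) : imp y (delta y x) = refl (imp y x) := by
  rw [imp_def, imp_def, sup_eq_left.2 (delta_le h), sup_eq_left.2 h, delta_invol x y h, refl_sup,
    refl_refl, sup_comm]

/-- A two-valued homomorphism for the implication. -/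
def IsValuation (φ : L → Prop) : Prop := ∀ x y, φ (imp x y) ↔ (φ x → φ y)

namespace IsValuation

variable {φ : L → Prop} (hφ : IsValuation φ)

include hφ

theorem map_top : φ ⊤ := by
  have h := hφ ⊤ ⊤
  rw [top_imp] at h
  tauto

theorem map_sup (x y : L) : φ (x ⊔ y) ↔ φ x ∨ φ y := by
  rw [← imp_imp_right, hφ, hφ]
  tauto

theorem comp_refl : IsValuation fun x => φ (refl x) := fun x y => by
  simp only [refl_imp]
  exact hφ _ _

theorem or_refl (x : L) : φ x ∨ φ (refl x) := by
  have h := hφ.map_top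
  rw [← refl_sup_self x, hφ.map_sup] at h
  exact h.symm

theorem mono {x y : L} (h : x ≤ y) (hx : φ x) : φ y := by
  rw [← sup_eq_right.2 h, hφ.map_sup]
  exact Or.inl hx

theorem map_delta {x y : L} (h : x ≤ y) :
    φ (delta y x) ↔ φ y ∧ (φ (refl y) → φ (refl x)) := by
  have h1 := hφ y (delta y x)
  rw [imp_delta h, refl_imp, hφ] at h1
  have h2 := hφ.mono (delta_le h)
  tauto

theorem map_refl_delta {x y : L} (h : x ≤ y) :
    φ (refl (delta y x)) ↔ φ (refl y) ∧ (φ y → φ x) := by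
  have h1 := hφ.comp_refl.map_delta h
  simpa only [refl_refl] using h1

end IsValuation

/-- A deductive system: a set that contains `⊤` and is closed under modus ponens. -/
def IsDeductive (F : Set L) : Prop :=
  ⊤ ∈ F ∧ ∀ x y, x ∈ F → imp x y ∈ F → y ∈ F

theorem isDeductive_singleton_top : IsDeductive ({⊤} : Set L) := by
  refine ⟨rfl, fun x y hx hxy => ?_⟩
  rw [Set.mem_singleton_iff] at *
  rwa [hx, top_imp] at hxy

theorem IsDeductive.mem_of_le {F : Set L} (hF : IsDeductive F) {x y : L} (h : x ≤ y)
    (hx : x ∈ F) : y ∈ F :=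
  hF.2 x y hx (imp_eq_top_of_le h ▸ hF.1)

/-- Deduction theorem: modus ponens under the premise p uses p twice, and `imp_contract` merges the
two uses. -/
theorem IsDeductive.adjoin {F : Set L} (hF : IsDeductive F) (p : L) :
    IsDeductive {z | imp p z ∈ F} := by
  refine ⟨hF.mem_of_le (le_imp _ _) hF.1, fun x y hx hxy => ?_⟩
  have h1 := hF.mem_of_le (imp_le_imp_imp p x (imp p y)) hx
  have h2 : imp x (imp p y) ∈ F := by rwa [imp_left_comm]
  have h3 := hF.2 _ _ h2 h1
  rwa [imp_contract] at h3

/-- By Zorn, take a deductive system containing x and maximal among those omitting y; membership in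
it is the valuation. -/
theorem exists_isValuation {x y : L} (hxy : ¬ x ≤ y) :
    ∃ φ : L → Prop, IsValuation φ ∧ φ x ∧ ¬ φ y := by
  let S : Set (Set L) := {F | IsDeductive F ∧ y ∉ F}
  have hS : {z | imp x z ∈ ({⊤} : Set L)} ∈ S :=
    ⟨isDeductive_singleton_top.adjoin x, fun h => hxy (imp_eq_top.1 h)⟩
  obtain ⟨F, hxF, hF⟩ := zorn_subset_nonempty S (by
    intro c hc hchain hne
    refine ⟨⋃₀ c, ⟨⟨?_, ?_⟩, ?_⟩, fun s hs => Set.subset_sUnion_of_mem hs⟩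
    · obtain ⟨s, hs⟩ := hne
      exact ⟨s, hs, (hc hs).1.1⟩
    · rintro a b ⟨s, hs, has⟩ ⟨t, ht, hbt⟩
      rcases hchain.total hs ht with h | h
      · exact ⟨t, ht, (hc ht).1.2 a b (h has) hbt⟩
      · exact ⟨s, hs, (hc hs).1.2 a b has (h hbt)⟩
    · rintro ⟨s, hs, hys⟩
      exact (hc hs).2 hys) _ hS
  have hD : IsDeductive F := hF.prop.1
  have hy : y ∉ F := hF.prop.2
  -- Otherwise adjoining p would still omit y, against maximality.
  have key : ∀ p, p ∉ F → imp p y ∈ F := by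
    intro p hp
    by_contra hpy
    have h1 : F ⊆ {z | imp p z ∈ F} := fun z hz => hD.mem_of_le (le_imp _ _) hz
    have h2 := hF.le_of_ge (y := {z | imp p z ∈ F}) ⟨hD.adjoin p, hpy⟩ h1
    apply hp
    apply h2
    change imp p p ∈ F
    rw [imp_eq_top_of_le le_rfl]
    exact hD.1
  refine ⟨(· ∈ F), fun p q => ⟨fun h hp => hD.2 p q hp h, fun h => ?_⟩, hxF (imp_eq_top_of_le le_rfl), hy⟩
  by_cases hp : p ∈ F
  · exact hD.mem_of_le (le_imp _ _) (h hp)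
  · by_contra hpq
    -- If both p and `imp p q` were outside F, then `imp p q ⊔ y` and `imp (imp p q) y` would lie in
    -- F, forcing y into F.
    have h1 := hD.mem_of_le (imp_le_imp_sup p q y) (key p hp)
    rw [← imp_imp_right] at h1
    exact hy (hD.2 _ _ (key _ hpq) h1)

theorem eq_of_forall_isValuation {x y : L} (h : ∀ φ : L → Prop, IsValuation φ → (φ x ↔ φ y)) :
    x = y := by
  apply le_antisymm <;> by_contra hn <;> obtain ⟨φ, hφ, h1, h2⟩ := exists_isValuation hn
  · exact h2 ((h φ hφ).1 h1)
  · exact h2 ((h φ hφ).2 h1)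

theorem IsValuation.map_star {φ : L → Prop} (hφ : IsValuation φ) (a b : L) :
    φ (star a b) ↔ φ a ∨ (φ b ∧ φ (refl b)) := by
  rw [star, hφ.map_sup, hφ.map_delta le_sup_right, refl_sup, hφ.map_sup, hφ.map_sup]
  have := hφ.or_refl a
  have := hφ.or_refl b
  tauto

theorem IsValuation.map_refl_star {φ : L → Prop} (hφ : IsValuation φ) (a b : L) :
    φ (refl (star a b)) ↔ φ (refl a) ∨ (φ b ∧ φ (refl b)) := by
  have h := hφ.comp_refl.map_star a b
  rw [refl_refl] at h
  tauto

/-- In the coding by pairs, a ≃ b means that the pair (true, true) occurs at the same φ for both. -/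
theorem simeq_iff {a b : L} :
    Simeq a b ↔ ∀ φ : L → Prop, IsValuation φ → (φ a ∧ φ (refl a) ↔ φ b ∧ φ (refl b)) := by
  constructor
  · intro h φ hφ
    have h1 := hφ.map_delta (le_sup_left : a ≤ a ⊔ b)
    have h2 := hφ.map_refl_delta (le_sup_left : a ≤ a ⊔ b)
    rw [h, refl_sup, hφ.map_sup, hφ.map_sup] at h1 h2
    have := hφ.or_refl a
    have := hφ.or_refl b
    tauto
  · intro h
    refine eq_of_forall_isValuation fun φ hφ => ?_
    rw [hφ.map_delta le_sup_left, refl_sup, hφ.map_sup, hφ.map_sup]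
    have := h φ hφ
    have := hφ.or_refl a
    have := hφ.or_refl b
    tauto

end CubicAlgebra

theorem mainTheorem7 {L : Type*} [CubicAlgebra L] :
    (∀ a b c d : L, CubicAlgebra.Simeq a d → CubicAlgebra.Simeq b c →
      CubicAlgebra.Simeq (CubicAlgebra.star a b) (CubicAlgebra.star d c)) ∧
    (∀ a b c : L, CubicAlgebra.star a (CubicAlgebra.star b c) =
      CubicAlgebra.star (CubicAlgebra.star a b) c) := by
  constructor
  · intro a b c d had hbc
    rw [CubicAlgebra.simeq_iff] at had hbc ⊢
    intro φ hφ
    have h1 := had φ hφ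
    have h2 := hbc φ hφ
    rw [hφ.map_star, hφ.map_refl_star, hφ.map_star, hφ.map_refl_star]
    tauto
  · intro a b c
    refine CubicAlgebra.eq_of_forall_isValuation fun φ hφ => ?_
    rw [hφ.map_star, hφ.map_star, hφ.map_star, hφ.map_star, hφ.map_refl_star]
    tauto
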